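/- Let $n$ be a positive integer, let $\mu=(\mu_1\ge\mu_2\ge\cdots\ge\mu_n\ge 0)$ be a partition with at most $n$ non-zero parts, let $\rho=(n-1,n-2,\ldots,1,0)$ and $\lambda=\mu+\rho$, i.e. $\lambda_j=\mu_j+n-j$. Let $\mathcal G^\lambda$ be the (finite) set of strict Gelfand–Tsetlin patterns with top row $\lambda$, that is, of triangular arrays $G=(m_{ij})_{1\le j\le i\le n}$ of non-negative integers such that $m_{nj}=\lambda_j$ for $1\le j\le n$, such that $$m_{i,j}\ge m_{i-1,j}\ge m_{i,j+1}\qquad(2\le i\le n,\ 1\le j\le i-1),$$ and such that every row is strictly decreasing, $m_{i,j}>m_{i,j+1}$ for $1\le j\le i-1$, $1\le i\le n$. For $G\in\mathcal G^\lambda$ let $\#R(G)$ and $\#B(G)$ be the numbers of pairs $(i,j)$ with $2\le i\le n$ and $1\le j\le i-1$ for which $$(R)\quad m_{i,j}>m_{i-1,j}=m_{i,j+1},\qquad\text{respectively}\qquad (B)\quad m_{i,j}>m_{i-1,j}>m_{i,j+1}.$$ Let $s_\mu(\mathbf x)=\sum_T\prod_{(i,j)}x_{T_{ij}}$ be the Schur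 function, the sum being over all semistandard tableaux $T$ of shape $\mu$ with entries in $\{1,\ldots,n\}$ (rows weakly increasing, columns strictly increasing) and the product over all boxes $(i,j)$ of the Young diagram of $\mu$. Then for all $\mathbf x=(x_1,\ldots,x_n)$ and all $t$ in a commutative ring, $$\sum_{G\in\mathcal G^\lambda}t^{\#R(G)}(1+t)^{\#B(G)}\prod_{i=1}^n x_i^{\sum_{j=1}^{i}m_{ij}-\sum_{j=1}^{i-1}m_{i-1,j}}=\prod_{1\le i<j\le n}(x_i+t\,x_j)\;s_\mu(\mathbf x),$$ where the $0$th row of $G$ is understood to be empty. -/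

import Mathlib

/-- A Gelfand–Tsetlin pattern of size `n`: a triangular array of non-negative integers whose
`i`-th row (`1 ≤ i ≤ n`) has the `i` entries `entry i 0, …, entry i (i - 1)`.
So `entry i j` is the entry usually written `m_{i,j+1}`: rows are numbered from `1`
(row `0` is empty), positions inside a row from `0`. Outside the triangle `entry` is set to `0`. -/
@[ext]
structure GTPattern (n : ℕ) where
  entry : ℕ → ℕ → ℕ
  zeros' : ∀ i j : ℕ, ¬ (j < i ∧ i ≤ n) → entry i j = 0
  between_left : ∀ i j : ℕ, i + 1 ≤ n → j < i → entry i j ≤ entry (i + 1) j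
  between_right : ∀ i j : ℕ, i + 1 ≤ n → j < i → entry (i + 1) (j + 1) ≤ entry i j

namespace GTPattern

/-- Every row is strictly decreasing. -/
def IsStrict {n : ℕ} (G : GTPattern n) : Prop :=
  ∀ i j : ℕ, i ≤ n → j + 1 < i → G.entry i (j + 1) < G.entry i j

/-- The sum of the entries of the `i`-th row (`0` for the empty row `i = 0`). -/
def rowSum {n : ℕ} (G : GTPattern n) (i : ℕ) : ℕ :=
  ∑ j ∈ Finset.range i, G.entry i j

/-- The number of triples `(m_{i+1,j}, m_{i,j}, m_{i+1,j+1})` that are right-saturated: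
`m_{i+1,j} > m_{i,j} = m_{i+1,j+1}`. -/
def numR {n : ℕ} (G : GTPattern n) : ℕ :=
  ∑ i ∈ Finset.range n, ((Finset.range i).filter fun j =>
    G.entry i j < G.entry (i + 1) j ∧ G.entry i j = G.entry (i + 1) (j + 1)).card

/-- The number of triples `(m_{i+1,j}, m_{i,j}, m_{i+1,j+1})` that are neither left- nor
right-saturated: `m_{i+1,j} > m_{i,j} > m_{i+1,j+1}`. -/
def numB {n : ℕ} (G : GTPattern n) : ℕ :=
  ∑ i ∈ Finset.range n, ((Finset.range i).filter fun j =>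
    G.entry i j < G.entry (i + 1) j ∧ G.entry (i + 1) (j + 1) < G.entry i j).card

/-- Row sums increase, so the natural-number differences of consecutive row sums that occur as
exponents are genuine differences. -/
theorem rowSum_le_rowSum_succ {n : ℕ} (G : GTPattern n) (i : ℕ) (hi : i + 1 ≤ n) :
    G.rowSum i ≤ G.rowSum (i + 1) := by
  unfold rowSum
  rw [Finset.sum_range_succ]
  exact le_trans (Finset.sum_le_sum fun j hj => G.between_left i j hi (Finset.mem_range.mp hj))
    (Nat.le_add_right _ _)

theorem entry_le_top {n : ℕ} (G : GTPattern n) (i j : ℕ) (hj : j < i) (hi : i ≤ n) :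
    G.entry i j ≤ G.entry n j := by
  induction hi using Nat.decreasingInduction with
  | self => exact le_rfl
  | of_succ k hk ih => exact le_trans (G.between_left k j hk hj) (ih (by omega))

end GTPattern

/-- The strict Gelfand–Tsetlin patterns of size `n` with top row `lam`. -/
def StrictGTPattern (n : ℕ) (lam : Fin n → ℕ) : Type :=
  {G : GTPattern n // G.IsStrict ∧ ∀ j : Fin n, G.entry n j = lam j}

instance (n : ℕ) (lam : Fin n → ℕ) : Finite (StrictGTPattern n lam) := by
  have key : ∀ (G : StrictGTPattern n lam) (i j : Fin (n + 1)),
      G.1.entry i j < (∑ k, lam k) + 1 := by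
    intro G i j
    by_cases h : (j : ℕ) < i ∧ (i : ℕ) ≤ n
    · have h1 := G.1.entry_le_top i j h.1 h.2
      have h2 : G.1.entry n j = lam ⟨j, by omega⟩ := G.2.2 ⟨j, by omega⟩
      have h3 := Finset.single_le_sum (f := lam) (fun _ _ => Nat.zero_le _)
        (Finset.mem_univ (⟨j, by omega⟩ : Fin n))
      omega
    · have := G.1.zeros' i j h
      omega
  refine Finite.of_injective (fun G : StrictGTPattern n lam =>
    fun (i j : Fin (n + 1)) => (⟨G.1.entry i j, key G i j⟩ : Fin ((∑ k, lam k) + 1))) ?_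
  intro G H hGH
  apply Subtype.ext
  apply GTPattern.ext
  funext i j
  by_cases h : j < i ∧ i ≤ n
  · have := congrFun (congrFun hGH ⟨i, by omega⟩) ⟨j, by omega⟩
    simpa using this
  · rw [G.1.zeros' i j h, H.1.zeros' i j h]

noncomputable instance (n : ℕ) (lam : Fin n → ℕ) : Fintype (StrictGTPattern n lam) :=
  Fintype.ofFinite _

/-- The semistandard Young tableaux of shape `μ` with entries in the alphabet `{0, …, n - 1}`,
which plays the role of `{1, …, n}`. -/
def BoundedSSYT (n : ℕ) (μ : YoungDiagram) : Type :=
  {T : SemistandardYoungTableau μ // ∀ c ∈ μ.cells, T c.1 c.2 < n}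

instance (n : ℕ) (μ : YoungDiagram) : Finite (BoundedSSYT n μ) := by
  refine Finite.of_injective (fun T : BoundedSSYT n μ =>
    fun c : {c // c ∈ μ.cells} => (⟨T.1 c.1.1 c.1.2, T.2 c.1 c.2⟩ : Fin n)) ?_
  intro T U hTU
  apply Subtype.ext
  ext i j
  by_cases h : (i, j) ∈ μ
  · have := congrFun hTU ⟨(i, j), h⟩
    simpa using this
  · rw [T.1.zeros h, U.1.zeros h]

noncomputable instance (n : ℕ) (μ : YoungDiagram) : Fintype (BoundedSSYT n μ) :=
  Fintype.ofFinite _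

/-- The Schur function `s_μ(x₁, …, xₙ)`: the sum over the semistandard tableaux of shape `μ` with
entries in the alphabet of the variables, of the product over all boxes of `x` at the entry. -/
noncomputable def schurFunction {R : Type*} [CommRing R] {n : ℕ} (μ : YoungDiagram)
    (x : Fin n → R) : R :=
  ∑ T : BoundedSSYT n μ, ∏ c : {c // c ∈ μ.cells}, x ⟨T.1 c.1.1 c.1.2, T.2 c.1 c.2⟩

/-! Write `V` for the product of the `x i - x j` and `P_t` for the product of the `x i + t * x j`,
both over `i < j`. The core is the division-free identity "sum times `V` equals `P_t` times
`alternant lam x`" (`tokuyamaSum_mul_prod_sub`), proved by induction on `n` by removing the top row.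
For a fixed top row, the sum over the interlacing rows of weight times alternant is, by
multilinearity, one determinant. A geometric sum evaluates its entries, and column operations
identify the result with the alternant of the top row (`prod_sub_mul_sum_interlacing`). Interlacing
rows that are not strict contribute nothing, because their alternants have two equal columns.

The Schur function enters through `t = 0`. Only patterns without right-saturated triples survive
there, and these correspond to semistandard tableaux with an extra monomial factor `P_0`
(`tokuyamaSum_zero`). Cancelling `P_0` in the core identity at `t = 0` gives the bialternant formula
`s_μ * V = alternant`. Substituting it for general `t` and cancelling `V` proves the theorem over a
domain with distinct non-zero `x i`. Polynomial variables over `ℤ` satisfy this, and specialization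
covers every commutative ring. -/

/-! ### Alternants and one interlacing step -/

/-- The weight of an entry `k` between the entries `a ≥ b` of the row above. -/
def tripleWeight {R : Type*} [CommRing R] (t : R) (a b k : ℕ) : R :=
  (if k < a ∧ k = b then t else 1) * (if k < a ∧ b < k then 1 + t else 1)

theorem sub_mul_sum_Ioo {R : Type*} [CommRing R] (y z : R) (b d : ℕ) :
    (z - y) * ∑ k ∈ Finset.Ioo b (b + d + 1), y ^ (b + d + 1 - k) * z ^ k =
      y * z ^ (b + d + 1) - y ^ (d + 1) * z ^ (b + 1) := by
  induction d with
  | zero =>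
    have h : Finset.Ioo b (b + 0 + 1) = ∅ := by
      ext k; simp only [Finset.mem_Ioo, Finset.notMem_empty, iff_false]; omega
    rw [h]
    simp
  | succ d ih =>
    have h : Finset.Ioo b (b + (d + 1) + 1) = insert (b + d + 1) (Finset.Ioo b (b + d + 1)) := by
      ext k; simp only [Finset.mem_Ioo, Finset.mem_insert]; omega
    have h2 : ∑ k ∈ Finset.Ioo b (b + d + 1), y ^ (b + (d + 1) + 1 - k) * z ^ k =
        y * ∑ k ∈ Finset.Ioo b (b + d + 1), y ^ (b + d + 1 - k) * z ^ k := by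
      rw [Finset.mul_sum]
      refine Finset.sum_congr rfl fun k hk => ?_
      rw [Finset.mem_Ioo] at hk
      rw [show b + (d + 1) + 1 - k = (b + d + 1 - k) + 1 by omega]
      ring
    rw [h, Finset.sum_insert (by simp), h2, mul_add, mul_left_comm _ y, ih,
      show b + (d + 1) + 1 - (b + d + 1) = 1 by omega]
    ring

/-- The weights are `t` at `k = b`, `1` at `k = a` and `1 + t` in between, so the sum is `(z + t *
y) * S` with `S` the sum of `y ^ (a - 1 - k) * z ^ k` over `b ≤ k < a`; then `(z - y) * S`
telescopes. For `a = b` the left sum would be `z ^ a` and the identity would fail, which is why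
strict rows are needed. -/
theorem sub_mul_sum_tripleWeight {R : Type*} [CommRing R] (t y z : R) {a b : ℕ} (h : b < a) :
    (z - y) * ∑ k ∈ Finset.Icc b a, tripleWeight t a b k * y ^ (a - k) * z ^ k =
      (z + t * y) * (z ^ a - y ^ (a - b) * z ^ b) := by
  obtain ⟨d, rfl⟩ : ∃ d, a = b + d + 1 := ⟨a - b - 1, by omega⟩
  have hI : Finset.Icc b (b + d + 1) = insert b (insert (b + d + 1) (Finset.Ioo b (b + d + 1))) := by
    ext k; simp only [Finset.mem_Ioo, Finset.mem_Icc, Finset.mem_insert]; omega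
  have hmid : ∑ k ∈ Finset.Ioo b (b + d + 1),
      tripleWeight t (b + d + 1) b k * y ^ (b + d + 1 - k) * z ^ k =
      (1 + t) * ∑ k ∈ Finset.Ioo b (b + d + 1), y ^ (b + d + 1 - k) * z ^ k := by
    rw [Finset.mul_sum]
    refine Finset.sum_congr rfl fun k hk => ?_
    rw [Finset.mem_Ioo] at hk
    rw [tripleWeight, if_neg (by omega), if_pos (by omega)]
    ring
  have hb : tripleWeight t (b + d + 1) b b = t := by
    rw [tripleWeight, if_pos (by omega), if_neg (by omega), mul_one]
  have ha : tripleWeight t (b + d + 1) b (b + d + 1) = 1 := by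
    rw [tripleWeight, if_neg (by omega), if_neg (by omega), mul_one]
  rw [hI, Finset.sum_insert (by simp), Finset.sum_insert (by simp), hmid, hb, ha,
    mul_add, mul_add, mul_left_comm _ (1 + t), sub_mul_sum_Ioo,
    show b + d + 1 - b = d + 1 by omega, show b + d + 1 - (b + d + 1) = 0 by omega]
  ring

/-- The alternant `det (x_i ^ lam_j)`. -/
def alternant {R : Type*} [CommRing R] {n : ℕ} (lam : Fin n → ℕ) (x : Fin n → R) : R :=
  (Matrix.of fun i j => x i ^ lam j).det

/-- Subtracting from each column the multiple `y ^ (lam j - lam (j+1))` of the next one, with `y`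
the last variable, clears the last row except for its last entry. -/
theorem alternant_succ {R : Type*} [CommRing R] {n : ℕ} (lam : Fin (n + 1) → ℕ)
    (hlam : Antitone lam) (x : Fin (n + 1) → R) :
    alternant lam x = x (Fin.last n) ^ lam (Fin.last n) *
      (Matrix.of fun i j : Fin n => x i.castSucc ^ lam j.castSucc -
        x (Fin.last n) ^ (lam j.castSucc - lam j.succ) * x i.castSucc ^ lam j.succ).det := by
  set y := x (Fin.last n) with hy
  -- Reversing both index orders turns "next column" into "preceding column" and the last row into
  -- row `0`, as the column-operation lemma and the row expansion require.
  set A : Matrix (Fin (n + 1)) (Fin (n + 1)) R := Matrix.of fun i j => x i.rev ^ lam j.rev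
  set c : Fin n → R := fun j => y ^ (lam j.rev.castSucc - lam j.rev.succ)
  set B : Matrix (Fin (n + 1)) (Fin (n + 1)) R :=
    Matrix.of fun i => Fin.cons (A i 0) fun j => A i j.succ - c j * A i j.castSucc with hB
  have hA : alternant lam x = A.det := by
    rw [alternant, ← Matrix.det_submatrix_equiv_self (Fin.revPerm (n := n + 1))]
    rfl
  have hAB : A.det = B.det := by
    refine Matrix.det_eq_of_forall_col_eq_smul_add_pred c (fun i => ?_) (fun i j => ?_)
    · simp [hB]
    · simp [hB]
  have hB0 : ∀ j : Fin n, B 0 j.succ = 0 := by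
    intro j
    have : lam j.rev.succ ≤ lam j.rev.castSucc := hlam (Fin.castSucc_lt_succ).le
    simp only [hB, A, c, Matrix.of_apply, Fin.cons_succ, Fin.rev_zero, Fin.rev_succ,
      Fin.rev_castSucc, ← hy, ← pow_add]
    rw [Nat.sub_add_cancel this, sub_self]
  have hB00 : B 0 0 = y ^ lam (Fin.last n) := by
    simp [hB, A, hy]
  rw [hA, hAB, Matrix.det_succ_row_zero, Fin.sum_univ_succ]
  simp only [hB0, hB00, mul_zero, zero_mul, Finset.sum_const_zero, add_zero, Fin.val_zero,
    pow_zero, one_mul]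
  congr 1
  rw [← Matrix.det_submatrix_equiv_self (Fin.revPerm (n := n))]
  congr 1
  ext i j
  simp [hB, A, c, Fin.rev_succ, Fin.rev_castSucc]

theorem Fin.prod_prod_Ioi_castSucc {M : Type*} [CommMonoid M] {n : ℕ}
    (f : Fin (n + 1) → Fin (n + 1) → M) :
    ∏ i, ∏ j ∈ Finset.Ioi i, f i j =
      (∏ i : Fin n, ∏ j ∈ Finset.Ioi i, f i.castSucc j.castSucc) *
        ∏ i : Fin n, f i.castSucc (Fin.last n) := by
  have key : ∀ i : Fin n, Finset.Ioi i.castSucc =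
      insert (Fin.last n) ((Finset.Ioi i).map Fin.castSuccEmb) := by
    intro i
    ext j
    refine Fin.lastCases ?_ (fun j => ?_) j
    · simp [Fin.castSucc_lt_last]
    · simpa using fun _ => Fin.le_last _
  rw [Fin.prod_univ_castSucc, ← Finset.prod_mul_distrib]
  have hl : Finset.Ioi (Fin.last n) = ∅ := by
    ext j; simp [Fin.le_last]
  rw [hl, Finset.prod_empty, mul_one]
  refine Finset.prod_congr rfl fun i _ => ?_
  rw [key, Finset.prod_insert (by simp), Finset.prod_map, mul_comm]
  rfl

/-- Multilinearity of the determinant in its columns: column `j` depends on `nu j` alone. -/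
theorem sum_piFinset_mul_alternant {R : Type*} [CommRing R] {n : ℕ} (s : Fin n → Finset ℕ)
    (w : Fin n → ℕ → R) (x : Fin n → R) :
    ∑ nu ∈ Fintype.piFinset s, (∏ j, w j (nu j)) * alternant nu x =
      (Matrix.of fun i j => ∑ k ∈ s j, w j k * x i ^ k).det := by
  simp only [alternant, Matrix.det_apply', Matrix.of_apply, Finset.mul_sum]
  rw [Finset.sum_comm]
  refine Finset.sum_congr rfl fun σ _ => ?_
  rw [Finset.prod_univ_sum, Finset.mul_sum]
  refine Finset.sum_congr rfl fun nu _ => ?_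
  rw [Finset.prod_mul_distrib]
  ring

/-- The rows that interlace the row `lam`. -/
def interlacing {n : ℕ} (lam : Fin (n + 1) → ℕ) : Finset (Fin n → ℕ) :=
  Fintype.piFinset fun j => Finset.Icc (lam j.succ) (lam j.castSucc)

theorem mem_interlacing {n : ℕ} {lam : Fin (n + 1) → ℕ} {nu : Fin n → ℕ} :
    nu ∈ interlacing lam ↔ ∀ j, lam j.succ ≤ nu j ∧ nu j ≤ lam j.castSucc := by
  simp [interlacing, Fintype.mem_piFinset]

/-- Consecutive entries of an interlacing row are separated by an entry of `lam`, so the row is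
weakly decreasing; if not strictly, two adjacent columns coincide. -/
theorem alternant_eq_zero {R : Type*} [CommRing R] {n : ℕ} {lam : Fin (n + 1) → ℕ}
    {nu : Fin n → ℕ} (hnu : nu ∈ interlacing lam) (h : ¬ StrictAnti nu) (x : Fin n → R) :
    alternant nu x = 0 := by
  rw [mem_interlacing] at hnu
  cases n with
  | zero => exact absurd (Subsingleton.strictAnti nu) h
  | succ m =>
    rw [Fin.strictAnti_iff_succ_lt] at h
    push Not at h
    obtain ⟨j, hj⟩ := h
    have h1 := (hnu j.castSucc).1
    have h2 := (hnu j.succ).2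
    rw [Fin.succ_castSucc] at h1
    have h3 : nu j.succ = nu j.castSucc := le_antisymm (h2.trans h1) hj
    refine Matrix.det_zero_of_column_eq (i := j.castSucc) (j := j.succ)
      (Fin.castSucc_lt_succ).ne fun i => ?_
    simp [h3]

/-- One step of Tokuyama's formula, in terms of alternants. -/
theorem prod_sub_mul_sum_interlacing {R : Type*} [CommRing R] {n : ℕ} (lam : Fin (n + 1) → ℕ)
    (hlam : StrictAnti lam) (x : Fin (n + 1) → R) (t : R) :
    (∏ i : Fin n, (x i.castSucc - x (Fin.last n))) *
      (x (Fin.last n) ^ lam (Fin.last n) * ∑ nu ∈ interlacing lam,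
        (∏ j, tripleWeight t (lam j.castSucc) (lam j.succ) (nu j) *
          x (Fin.last n) ^ (lam j.castSucc - nu j)) * alternant nu fun i => x i.castSucc) =
      (∏ i : Fin n, (x i.castSucc + t * x (Fin.last n))) * alternant lam x := by
  -- The factors `x i - x n` and `x i + t * x n` are absorbed into row `i` of the two determinants,
  -- which then agree entry by entry.
  rw [interlacing, sum_piFinset_mul_alternant _ (fun j k =>
    tripleWeight t (lam j.castSucc) (lam j.succ) k * x (Fin.last n) ^ (lam j.castSucc - k)),
    alternant_succ lam hlam.antitone x, mul_left_comm, mul_left_comm _ (_ ^ _),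
    ← Matrix.det_mul_column, ← Matrix.det_mul_column]
  congr 3
  ext i j
  exact sub_mul_sum_tripleWeight t _ _ (hlam Fin.castSucc_lt_succ)

/-! ### Adding and removing the top row of a pattern -/

namespace GTPattern

/-- The pattern without its top row. -/
def restrict {n : ℕ} (G : GTPattern (n + 1)) : GTPattern n where
  entry i j := if i ≤ n then G.entry i j else 0
  zeros' i j h := by
    split_ifs with hi
    · exact G.zeros' i j (by omega)
    · rfl
  between_left i j hi hj := by
    rw [if_pos (show i ≤ n by omega), if_pos hi]
    exact G.between_left i j (by omega) hj
  between_right i j hi hj := by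
    rw [if_pos (show i ≤ n by omega), if_pos hi]
    exact G.between_right i j (by omega) hj

/-- The pattern with one more row put on top. -/
def extend {n : ℕ} (G : GTPattern n) (lam : Fin (n + 1) → ℕ)
    (h : (fun j : Fin n => G.entry n j) ∈ interlacing lam) : GTPattern (n + 1) where
  entry i j := if i = n + 1 then (if hj : j < n + 1 then lam ⟨j, hj⟩ else 0) else G.entry i j
  zeros' i j hij := by
    split_ifs with hi hj
    · omega
    · rfl
    · exact G.zeros' i j (by omega)
  between_left i j hi hj := by
    rw [if_neg (by omega)]
    split_ifs with h1 h2
    · obtain rfl : i = n := by omega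
      exact (mem_interlacing.mp h ⟨j, hj⟩).2
    · omega
    · exact G.between_left i j (by omega) hj
  between_right i j hi hj := by
    rw [if_neg (by omega : ¬ i = n + 1)]
    split_ifs with h1 h2
    · obtain rfl : i = n := by omega
      exact (mem_interlacing.mp h ⟨j, hj⟩).1
    · omega
    · exact G.between_right i j (by omega) hj

theorem extend_entry_of_le {n : ℕ} (G : GTPattern n) (lam : Fin (n + 1) → ℕ)
    (h : (fun j : Fin n => G.entry n j) ∈ interlacing lam) {i : ℕ} (hi : i ≤ n) (j : ℕ) :
    (G.extend lam h).entry i j = G.entry i j :=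
  if_neg (by omega)

theorem extend_entry_top {n : ℕ} (G : GTPattern n) (lam : Fin (n + 1) → ℕ)
    (h : (fun j : Fin n => G.entry n j) ∈ interlacing lam) (j : Fin (n + 1)) :
    (G.extend lam h).entry (n + 1) j = lam j :=
  (if_pos rfl).trans (dif_pos j.2)

theorem extend_rowSum_of_le {n : ℕ} (G : GTPattern n) (lam : Fin (n + 1) → ℕ)
    (h : (fun j : Fin n => G.entry n j) ∈ interlacing lam) {i : ℕ} (hi : i ≤ n) :
    (G.extend lam h).rowSum i = G.rowSum i :=
  Finset.sum_congr rfl fun j _ => extend_entry_of_le G lam h hi j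

theorem rowSum_eq_sum_fin {n : ℕ} (G : GTPattern n) (i : ℕ) :
    G.rowSum i = ∑ j : Fin i, G.entry i j :=
  Finset.sum_range _

theorem extend_rowSum_sub {n : ℕ} (G : GTPattern n) (lam : Fin (n + 1) → ℕ)
    (h : (fun j : Fin n => G.entry n j) ∈ interlacing lam) :
    (G.extend lam h).rowSum (n + 1) - (G.extend lam h).rowSum n =
      (∑ j : Fin n, (lam j.castSucc - G.entry n j)) + lam (Fin.last n) := by
  rw [extend_rowSum_of_le G lam h le_rfl, rowSum_eq_sum_fin, rowSum_eq_sum_fin,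
    Fin.sum_univ_castSucc, Finset.sum_tsub_distrib _ fun j _ => (mem_interlacing.mp h j).2]
  simp only [extend_entry_top]
  have : ∑ j : Fin n, G.entry n j ≤ ∑ j : Fin n, lam j.castSucc :=
    Finset.sum_le_sum fun j _ => (mem_interlacing.mp h j).2
  omega

theorem pow_sum_card_range_succ {R : Type*} [CommRing R] (t : R) (n : ℕ)
    (p : ℕ → ℕ → Prop) [∀ i j, Decidable (p i j)] :
    t ^ (∑ i ∈ Finset.range (n + 1), ((Finset.range i).filter (p i)).card) =
      t ^ (∑ i ∈ Finset.range n, ((Finset.range i).filter (p i)).card) *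
        ∏ j : Fin n, if p n j then t else 1 := by
  rw [Finset.sum_range_succ, pow_add]
  congr 1
  rw [← Finset.prod_const, Finset.prod_filter, Finset.prod_range]

theorem extend_pow_numR {R : Type*} [CommRing R] (t : R) {n : ℕ} (G : GTPattern n)
    (lam : Fin (n + 1) → ℕ) (h : (fun j : Fin n => G.entry n j) ∈ interlacing lam) :
    t ^ (G.extend lam h).numR = t ^ G.numR * ∏ j : Fin n,
      if G.entry n j < lam j.castSucc ∧ G.entry n j = lam j.succ then t else 1 := by
  have h1 : t ^ (G.extend lam h).numR = _ := pow_sum_card_range_succ t n _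
  rw [h1]
  congr 1
  · congr 1
    refine Finset.sum_congr rfl fun i hi => ?_
    rw [Finset.mem_range] at hi
    simp only [extend_entry_of_le G lam h (show i ≤ n by omega),
      extend_entry_of_le G lam h (show i + 1 ≤ n by omega)]
  · refine Finset.prod_congr rfl fun j _ => ?_
    rw [extend_entry_of_le G lam h le_rfl, ← extend_entry_top G lam h j.castSucc,
      ← extend_entry_top G lam h j.succ]
    rfl

theorem extend_pow_numB {R : Type*} [CommRing R] (t : R) {n : ℕ} (G : GTPattern n)
    (lam : Fin (n + 1) → ℕ) (h : (fun j : Fin n => G.entry n j) ∈ interlacing lam) :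
    t ^ (G.extend lam h).numB = t ^ G.numB * ∏ j : Fin n,
      if G.entry n j < lam j.castSucc ∧ lam j.succ < G.entry n j then t else 1 := by
  have h1 : t ^ (G.extend lam h).numB = _ := pow_sum_card_range_succ t n _
  rw [h1]
  congr 1
  · congr 1
    refine Finset.sum_congr rfl fun i hi => ?_
    rw [Finset.mem_range] at hi
    simp only [extend_entry_of_le G lam h (show i ≤ n by omega),
      extend_entry_of_le G lam h (show i + 1 ≤ n by omega)]
  · refine Finset.prod_congr rfl fun j _ => ?_
    rw [extend_entry_of_le G lam h le_rfl, ← extend_entry_top G lam h j.castSucc,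
      ← extend_entry_top G lam h j.succ]
    rfl

/-- The summand of Tokuyama's formula at `G`. -/
def weight {R : Type*} [CommRing R] {n : ℕ} (G : GTPattern n) (x : Fin n → R) (t : R) : R :=
  t ^ G.numR * (1 + t) ^ G.numB *
    ∏ i : Fin n, x i ^ (G.rowSum ((i : ℕ) + 1) - G.rowSum (i : ℕ))

theorem extend_weight {R : Type*} [CommRing R] {n : ℕ} (G : GTPattern n)
    (lam : Fin (n + 1) → ℕ) (h : (fun j : Fin n => G.entry n j) ∈ interlacing lam)
    (x : Fin (n + 1) → R) (t : R) :
    (G.extend lam h).weight x t =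
      x (Fin.last n) ^ lam (Fin.last n) *
        (∏ j : Fin n, tripleWeight t (lam j.castSucc) (lam j.succ) (G.entry n j) *
          x (Fin.last n) ^ (lam j.castSucc - G.entry n j)) *
        G.weight (fun i => x i.castSucc) t := by
  have hx : ∏ i : Fin (n + 1),
      x i ^ ((G.extend lam h).rowSum ((i : ℕ) + 1) - (G.extend lam h).rowSum (i : ℕ)) =
      (∏ i : Fin n, x i.castSucc ^ (G.rowSum ((i : ℕ) + 1) - G.rowSum (i : ℕ))) *
        ((∏ j : Fin n, x (Fin.last n) ^ (lam j.castSucc - G.entry n j)) *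
          x (Fin.last n) ^ lam (Fin.last n)) := by
    rw [Fin.prod_univ_castSucc]
    congr 1
    · refine Finset.prod_congr rfl fun i _ => ?_
      rw [Fin.val_castSucc, extend_rowSum_of_le G lam h (by omega),
        extend_rowSum_of_le G lam h (by omega)]
    · rw [Fin.val_last, extend_rowSum_sub, pow_add, Finset.prod_pow_eq_pow_sum]
  rw [weight, weight, hx, extend_pow_numR, extend_pow_numB]
  simp only [tripleWeight, Finset.prod_mul_distrib]
  ring

end GTPattern

/-! ### The recursion on the top row and the alternant identity -/

/-- The sum over strict patterns in Tokuyama's formula. -/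
noncomputable def tokuyamaSum {R : Type*} [CommRing R] {n : ℕ} (lam : Fin n → ℕ)
    (x : Fin n → R) (t : R) : R :=
  ∑ G : StrictGTPattern n lam, G.1.weight x t

namespace StrictGTPattern

theorem top_eq {n : ℕ} {lam : Fin n → ℕ} (G : StrictGTPattern n lam) :
    (fun j : Fin n => G.1.entry n j) = lam :=
  funext G.2.2

/-- The strict pattern with one more row put on top. -/
def extend {n : ℕ} {nu : Fin n → ℕ} (G : StrictGTPattern n nu) (lam : Fin (n + 1) → ℕ)
    (hlam : StrictAnti lam) (h : nu ∈ interlacing lam) : StrictGTPattern (n + 1) lam :=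
  ⟨G.1.extend lam (G.top_eq.symm ▸ h), by
    intro i j hi hj
    rcases Nat.lt_or_ge n i with hn | hn
    · obtain rfl : i = n + 1 := by omega
      rw [G.1.extend_entry_top lam _ ⟨j + 1, hj⟩, G.1.extend_entry_top lam _ ⟨j, by omega⟩]
      exact hlam (by simp)
    · rw [G.1.extend_entry_of_le lam _ hn, G.1.extend_entry_of_le lam _ hn]
      exact G.2.1 i j hn hj, fun j => G.1.extend_entry_top lam _ j⟩

theorem extend_entry_of_le {n : ℕ} {nu : Fin n → ℕ} (G : StrictGTPattern n nu)
    (lam : Fin (n + 1) → ℕ) (hlam : StrictAnti lam) (h : nu ∈ interlacing lam) {i : ℕ}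
    (hi : i ≤ n) (j : ℕ) : (G.extend lam hlam h).1.entry i j = G.1.entry i j :=
  G.1.extend_entry_of_le lam (G.top_eq.symm ▸ h) hi j

end StrictGTPattern

open Classical in
theorem tokuyamaSum_succ {R : Type*} [CommRing R] {n : ℕ} (lam : Fin (n + 1) → ℕ)
    (hlam : StrictAnti lam) (x : Fin (n + 1) → R) (t : R) :
    tokuyamaSum lam x t = ∑ nu ∈ (interlacing lam).filter StrictAnti,
      x (Fin.last n) ^ lam (Fin.last n) *
        (∏ j : Fin n, tripleWeight t (lam j.castSucc) (lam j.succ) (nu j) *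
          x (Fin.last n) ^ (lam j.castSucc - nu j)) *
        tokuyamaSum nu (fun i => x i.castSucc) t := by
  simp only [tokuyamaSum, Finset.mul_sum]
  rw [Finset.sum_sigma']
  symm
  refine Finset.sum_bij (fun a ha => a.2.extend lam hlam ?_) ?_ ?_ ?_ ?_
  · simp only [Finset.mem_sigma, Finset.mem_filter] at ha
    exact ha.1.1
  · intro a ha
    exact Finset.mem_univ _
  · rintro ⟨nu, G⟩ ha ⟨nu', G'⟩ ha' hG
    have hent : ∀ i ≤ n, ∀ j, G.1.entry i j = G'.1.entry i j := by
      intro i hi j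
      simp only [Finset.mem_sigma, Finset.mem_filter] at ha ha'
      rw [← G.extend_entry_of_le lam hlam ha.1.1 hi, ← G'.extend_entry_of_le lam hlam ha'.1.1 hi]
      exact congrArg (fun H : StrictGTPattern (n + 1) lam => H.1.entry i j) hG
    obtain rfl : nu = nu' := by
      rw [← G.top_eq, ← G'.top_eq]
      exact funext fun j => hent n le_rfl j
    congr 1
    apply Subtype.ext
    apply GTPattern.ext
    funext i j
    by_cases hi : i ≤ n
    · exact hent i hi j
    · rw [G.1.zeros' i j (by omega), G'.1.zeros' i j (by omega)]
  · intro G _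
    have hr : ∀ i ≤ n, ∀ j, G.1.restrict.entry i j = G.1.entry i j := fun i hi j => if_pos hi
    let nu : Fin n → ℕ := fun j => G.1.entry n j
    have hnu : nu ∈ interlacing lam := by
      rw [mem_interlacing]
      intro j
      rw [← G.2.2 j.succ, ← G.2.2 j.castSucc]
      exact ⟨G.1.between_right n j le_rfl j.2, G.1.between_left n j le_rfl j.2⟩
    have hs : StrictAnti nu := by
      cases n with
      | zero => exact Subsingleton.strictAnti nu
      | succ m =>
        rw [Fin.strictAnti_iff_succ_lt]
        intro j
        exact G.2.1 (m + 1) j (by omega) (by omega)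
    refine ⟨⟨nu, ⟨G.1.restrict, ?_, fun j => hr n le_rfl j⟩⟩, ?_, ?_⟩
    · intro i j hi hj
      rw [hr i hi, hr i hi]
      exact G.2.1 i j (by omega) hj
    · exact Finset.mem_sigma.mpr ⟨Finset.mem_filter.mpr ⟨hnu, hs⟩, Finset.mem_univ _⟩
    · apply Subtype.ext
      apply GTPattern.ext
      funext i j
      rcases Nat.lt_or_ge n i with hn | hn
      · by_cases hi : j < i ∧ i ≤ n + 1
        · obtain rfl : i = n + 1 := by omega
          rw [G.2.2 ⟨j, hi.1⟩]
          exact (StrictGTPattern.extend _ lam hlam hnu).2.2 ⟨j, hi.1⟩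
        · rw [G.1.zeros' i j hi]
          exact GTPattern.zeros' _ i j hi
      · rw [StrictGTPattern.extend_entry_of_le _ lam hlam _ hn]
        exact hr i hn j
  · rintro ⟨nu, G⟩ ha
    have h : nu ∈ interlacing lam := (Finset.mem_filter.mp (Finset.mem_sigma.mp ha).1).1
    refine Eq.trans ?_ (G.1.extend_weight lam (G.top_eq.symm ▸ h) x t).symm
    simp only [G.2.2]

/-- Keeping the Vandermonde product on the left avoids division, so the induction runs over an
arbitrary commutative ring. -/
theorem tokuyamaSum_mul_prod_sub {R : Type*} [CommRing R] {n : ℕ} (lam : Fin n → ℕ)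
    (hlam : StrictAnti lam) (x : Fin n → R) (t : R) :
    tokuyamaSum lam x t * ∏ i : Fin n, ∏ j ∈ Finset.Ioi i, (x i - x j) =
      (∏ i : Fin n, ∏ j ∈ Finset.Ioi i, (x i + t * x j)) * alternant lam x := by
  classical
  induction n with
  | zero =>
    have huniq : ∀ G : StrictGTPattern 0 lam, G.1.weight x t = 1 := by
      intro G
      simp [GTPattern.weight, GTPattern.numR, GTPattern.numB]
    have hcard : Fintype.card (StrictGTPattern 0 lam) = 1 := by
      rw [Fintype.card_eq_one_iff]
      refine ⟨⟨⟨fun _ _ => 0, fun _ _ _ => rfl, fun _ _ _ _ => le_rfl, fun _ _ _ _ => le_rfl⟩,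
        fun i j hi hj => absurd hj (by omega), fun j => j.elim0⟩, fun G => ?_⟩
      apply Subtype.ext
      apply GTPattern.ext
      funext i j
      exact G.1.zeros' i j (by omega)
    simp [tokuyamaSum, huniq, hcard, alternant]
  | succ n ih =>
    rw [tokuyamaSum_succ lam hlam, Fin.prod_prod_Ioi_castSucc, Fin.prod_prod_Ioi_castSucc,
      mul_assoc, ← prod_sub_mul_sum_interlacing lam hlam x t, ← mul_assoc, Finset.sum_mul,
      mul_left_comm, mul_comm (∏ i : Fin n, (x i.castSucc - x (Fin.last n)))]
    congr 1
    -- The recursion sums over strict rows and the determinant step over all interlacing rows; the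
    -- vanishing alternants reconcile the two.
    rw [← Finset.sum_filter_of_ne (p := StrictAnti) (s := interlacing lam), Finset.mul_sum,
      Finset.mul_sum]
    · refine Finset.sum_congr rfl fun nu hnu => ?_
      rw [Finset.mem_filter] at hnu
      rw [mul_assoc, ih nu hnu.2]
      ring
    · intro nu hnu h
      by_contra hns
      exact h (by rw [alternant_eq_zero hnu hns, mul_zero])

/-! ### From tableaux to patterns without right-saturated triples -/

/-- A downward closed subset of an initial segment is itself an initial segment, so its cardinality
is its threshold. -/
theorem lt_card_filter_range_iff {L : ℕ} {p : ℕ → Prop} [DecidablePred p]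
    (hp : ∀ a b, a ≤ b → b < L → p b → p a) (c : ℕ) :
    c < ((Finset.range L).filter p).card ↔ c < L ∧ p c := by
  constructor
  · intro h
    by_contra hc
    refine absurd h (not_lt.mpr ?_)
    rw [← Finset.card_range c]
    refine Finset.card_le_card fun a ha => ?_
    rw [Finset.mem_filter, Finset.mem_range] at ha
    rw [Finset.mem_range]
    by_contra hac
    exact hc ⟨by omega, hp c a (by omega) ha.1 ha.2⟩
  · rintro ⟨h1, h2⟩
    refine lt_of_lt_of_le (Nat.lt_add_one c) ?_
    rw [← Finset.card_range (c + 1)]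
    refine Finset.card_le_card fun a ha => ?_
    rw [Finset.mem_range] at ha
    rw [Finset.mem_filter, Finset.mem_range]
    exact ⟨by omega, hp a c (by omega) h1 h2⟩

theorem YoungDiagram.rowLen_eq_zero_of_length_le (μ : YoungDiagram) {n j : ℕ}
    (hμ : μ.rowLens.length ≤ n) (hj : n ≤ j) : μ.rowLen j = 0 := by
  rw [YoungDiagram.length_rowLens] at hμ
  by_contra h
  have : (j, 0) ∈ μ := YoungDiagram.mem_iff_lt_rowLen.mpr (Nat.pos_of_ne_zero h)
  rw [YoungDiagram.mem_iff_lt_colLen] at this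
  omega

namespace SemistandardYoungTableau

/-- The number of entries less than `i` in row `j`. -/
def rowCount {μ : YoungDiagram} (T : SemistandardYoungTableau μ) (i j : ℕ) : ℕ :=
  ((Finset.range (μ.rowLen j)).filter fun c => T j c < i).card

theorem lt_rowCount_iff {μ : YoungDiagram} (T : SemistandardYoungTableau μ) {i j c : ℕ} :
    c < T.rowCount i j ↔ c < μ.rowLen j ∧ T j c < i := by
  refine lt_card_filter_range_iff (fun a b hab hb h => ?_) c
  exact lt_of_le_of_lt (T.row_weak_of_le hab (YoungDiagram.mem_iff_lt_rowLen.mpr hb)) h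

theorem rowCount_le_rowLen {μ : YoungDiagram} (T : SemistandardYoungTableau μ) (i j : ℕ) :
    T.rowCount i j ≤ μ.rowLen j :=
  le_of_forall_lt fun _ hc => (T.lt_rowCount_iff.mp hc).1

theorem rowCount_mono {μ : YoungDiagram} (T : SemistandardYoungTableau μ) (i j : ℕ) :
    T.rowCount i j ≤ T.rowCount (i + 1) j :=
  le_of_forall_lt fun _ hc => T.lt_rowCount_iff.mpr
    ⟨(T.lt_rowCount_iff.mp hc).1, Nat.lt_succ_of_lt (T.lt_rowCount_iff.mp hc).2⟩

theorem rowCount_succ_le {μ : YoungDiagram} (T : SemistandardYoungTableau μ) (i j : ℕ) :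
    T.rowCount (i + 1) (j + 1) ≤ T.rowCount i j := by
  refine le_of_forall_lt fun c hc => T.lt_rowCount_iff.mpr ?_
  obtain ⟨h1, h2⟩ := T.lt_rowCount_iff.mp hc
  have h3 := T.col_strict (Nat.lt_add_one j) (YoungDiagram.mem_iff_lt_rowLen.mpr h1)
  exact ⟨lt_of_lt_of_le h1 (μ.rowLen_anti _ _ (Nat.le_succ j)), by omega⟩

theorem le_entry {μ : YoungDiagram} (T : SemistandardYoungTableau μ) {j c : ℕ}
    (h : (j, c) ∈ μ) : j ≤ T j c := by
  induction j with
  | zero => exact Nat.zero_le _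
  | succ j ih =>
    have h1 := ih (μ.up_left_mem (Nat.le_succ j) le_rfl h)
    have h2 := T.col_strict (Nat.lt_add_one j) h
    omega

/-- Entries in row `j` are at least `j`, so rows `j ≥ i` hold no entry below `i` and truncating the
sum at `i` loses nothing. -/
theorem sum_rowCount {μ : YoungDiagram} (T : SemistandardYoungTableau μ) (i : ℕ) :
    ∑ j ∈ Finset.range i, T.rowCount i j =
      (μ.cells.filter fun c => T c.1 c.2 < i).card := by
  rw [Finset.card_eq_sum_card_fiberwise (f := Prod.fst) (t := Finset.range i)]
  · refine Finset.sum_congr rfl fun j _ => ?_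
    refine Finset.card_bij (fun c _ => (j, c)) ?_ ?_ ?_
    · intro c hc
      rw [Finset.mem_filter, Finset.mem_range] at hc
      simp only [Finset.mem_filter, YoungDiagram.mem_cells, YoungDiagram.mem_iff_lt_rowLen]
      exact ⟨hc, trivial⟩
    · intro a _ b _ hab
      exact (Prod.ext_iff.mp hab).2
    · rintro ⟨a, b⟩ hab
      simp only [Finset.mem_filter, YoungDiagram.mem_cells, YoungDiagram.mem_iff_lt_rowLen] at hab
      obtain ⟨hab, rfl⟩ := hab
      exact ⟨b, by rw [Finset.mem_filter, Finset.mem_range]; exact hab, rfl⟩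
  · rintro ⟨a, b⟩ hab
    simp only [Finset.coe_filter, Set.mem_ofPred_eq, YoungDiagram.mem_cells] at hab
    simp only [Finset.coe_range, Set.mem_Iio]
    exact lt_of_le_of_lt (T.le_entry hab.1) hab.2

end SemistandardYoungTableau

namespace BoundedSSYT

/-- The pattern whose entries are the shifted numbers of small entries in the rows of `T`. -/
def toGTPattern {n : ℕ} {μ : YoungDiagram} (T : BoundedSSYT n μ) : GTPattern n where
  -- The shift `n - 1 - j` depends on the position but not on the row. It thus preserves the left
  -- inequality, while its drop by one from `j` to `j + 1` makes the right inequality strict.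
  entry i j := if j < i ∧ i ≤ n then T.1.rowCount i j + (n - 1 - j) else 0
  zeros' i j h := if_neg h
  between_left i j hi hj := by
    rw [if_pos (by omega), if_pos (by omega)]
    have := T.1.rowCount_mono i j
    omega
  between_right i j hi hj := by
    rw [if_pos (by omega), if_pos (by omega)]
    have := T.1.rowCount_succ_le i j
    omega

theorem toGTPattern_entry {n : ℕ} {μ : YoungDiagram} (T : BoundedSSYT n μ) {i j : ℕ}
    (hj : j < i) (hi : i ≤ n) :
    T.toGTPattern.entry i j = T.1.rowCount i j + (n - 1 - j) :=
  if_pos ⟨hj, hi⟩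

theorem rowCount_top {n : ℕ} {μ : YoungDiagram} (T : BoundedSSYT n μ) (j : ℕ) :
    T.1.rowCount n j = μ.rowLen j := by
  refine le_antisymm (T.1.rowCount_le_rowLen n j) (le_of_forall_lt fun c hc => ?_)
  exact T.1.lt_rowCount_iff.mpr ⟨hc, T.2 (j, c) (YoungDiagram.mem_iff_lt_rowLen.mpr hc)⟩

/-- `toGTPattern` as a strict pattern. -/
def toStrictGTPattern {n : ℕ} {μ : YoungDiagram} (T : BoundedSSYT n μ) (lam : Fin n → ℕ)
    (hlam : ∀ j : Fin n, lam j = μ.rowLen j + (n - 1 - (j : ℕ))) : StrictGTPattern n lam :=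
  ⟨T.toGTPattern, by
    intro i j hi hj
    rw [T.toGTPattern_entry hj hi, T.toGTPattern_entry (by omega) hi]
    have h1 := T.1.rowCount_succ_le i j
    have h2 := T.1.rowCount_mono i (j + 1)
    omega, fun j => by
    rw [T.toGTPattern_entry j.2 le_rfl, T.rowCount_top, hlam]⟩

theorem numR_toGTPattern {n : ℕ} {μ : YoungDiagram} (T : BoundedSSYT n μ) :
    T.toGTPattern.numR = 0 := by
  rw [GTPattern.numR, Finset.sum_eq_zero_iff]
  intro i hi
  rw [Finset.card_eq_zero, Finset.filter_eq_empty_iff]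
  intro j hj
  rw [Finset.mem_range] at hi hj
  rw [T.toGTPattern_entry hj hi.le, T.toGTPattern_entry (by omega) (by omega : i + 1 ≤ n),
    T.toGTPattern_entry (by omega) (by omega : i + 1 ≤ n)]
  have h1 := T.1.rowCount_succ_le i j
  omega

theorem toGTPattern_injective {n : ℕ} {μ : YoungDiagram} :
    Function.Injective (toGTPattern : BoundedSSYT n μ → GTPattern n) := by
  intro T U h
  have key : ∀ i ≤ n, ∀ j c, (j, c) ∈ μ → (T.1 j c < i ↔ U.1 j c < i) := by
    intro i hi j c hc
    by_cases hj : j < i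
    · have h1 : T.1.rowCount i j = U.1.rowCount i j := by
        have := congrArg (fun G : GTPattern n => G.entry i j) h
        simp only [toGTPattern_entry _ hj hi] at this
        omega
      have h2 := T.1.lt_rowCount_iff (i := i) (j := j) (c := c)
      have h3 := U.1.lt_rowCount_iff (i := i) (j := j) (c := c)
      have h4 := YoungDiagram.mem_iff_lt_rowLen.mp hc
      rw [h1] at h2
      tauto
    -- The pattern stores nothing for `j ≥ i`, but there both entries are at least `j`, so neither
    -- is below `i`.
    · have h1 := T.1.le_entry hc
      have h2 := U.1.le_entry hc
      omega
  apply Subtype.ext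
  ext j c
  by_cases hc : (j, c) ∈ μ
  · have h1 := key (T.1 j c + 1) (T.2 (j, c) hc) j c hc
    have h2 := key (U.1 j c + 1) (U.2 (j, c) hc) j c hc
    omega
  · rw [T.1.zeros hc, U.1.zeros hc]

end BoundedSSYT

/-! ### From patterns without right-saturated triples back to tableaux -/

namespace GTPattern

theorem entry_mono {n : ℕ} (G : GTPattern n) {i i' : ℕ} (j : ℕ) (hi : i ≤ i') (hn : i' ≤ n) :
    G.entry i j ≤ G.entry i' j := by
  induction i', hi using Nat.le_induction with
  | base => exact le_rfl
  | succ k hk ih =>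
    refine (ih (by omega)).trans ?_
    by_cases hj : j < k
    · exact G.between_left k j hn hj
    · rw [G.zeros' k j (by omega)]
      exact Nat.zero_le _

/-- Equality would force the triple to be right-saturated, since strictness of row `i + 1` rules out
all three entries being equal. -/
theorem entry_succ_lt_of_numR_eq_zero {n : ℕ} (G : GTPattern n) (hs : G.IsStrict)
    (hR : G.numR = 0) {i j : ℕ} (hi : i + 1 ≤ n) (hj : j < i) :
    G.entry (i + 1) (j + 1) < G.entry i j := by
  rw [numR, Finset.sum_eq_zero_iff] at hR
  have h1 := hR i (Finset.mem_range.mpr hi)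
  rw [Finset.card_eq_zero, Finset.filter_eq_empty_iff] at h1
  have h2 := h1 (Finset.mem_range.mpr hj)
  have h3 := G.between_right i j hi hj
  have h4 := hs (i + 1) j hi (by omega)
  omega

end GTPattern

namespace StrictGTPattern

/-- The entry in column `c` of row `j` of the tableau of a pattern without right-saturated
triples. -/
noncomputable def tableauEntry {n : ℕ} {lam : Fin n → ℕ} (G : StrictGTPattern n lam)
    (j c : ℕ) : ℕ :=
  sInf {v | c + (n - 1 - j) < G.1.entry (v + 1) j}

/-- Entries at a fixed position grow with the row index, so the infimum is a threshold. `htop` makes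
the set non-empty, excluding the default value `0` of `sInf`. -/
theorem tableauEntry_lt_iff {n : ℕ} {lam : Fin n → ℕ} (G : StrictGTPattern n lam) {i j c : ℕ}
    (hi : i ≤ n) (htop : c + (n - 1 - j) < G.1.entry n j) :
    G.tableauEntry j c < i ↔ c + (n - 1 - j) < G.1.entry i j := by
  have hn : 0 < n := by
    by_contra h
    rw [G.1.zeros' n j (by omega)] at htop
    omega
  have hne : {v | c + (n - 1 - j) < G.1.entry (v + 1) j}.Nonempty :=
    ⟨n - 1, by rw [Set.mem_ofPred_eq, Nat.sub_add_cancel hn]; exact htop⟩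
  constructor
  · intro h
    have hmem := Nat.sInf_mem hne
    exact lt_of_lt_of_le hmem (G.1.entry_mono j h hi)
  · intro h
    have hi0 : 0 < i := by
      by_contra h0
      rw [G.1.zeros' i j (by omega)] at h
      omega
    refine lt_of_le_of_lt (Nat.sInf_le (m := i - 1) ?_) (by omega)
    rw [Set.mem_ofPred_eq, Nat.sub_add_cancel hi0]
    exact h

theorem lt_entry_top_of_mem {n : ℕ} {μ : YoungDiagram} (hμ : μ.rowLens.length ≤ n)
    {lam : Fin n → ℕ} (hlam : ∀ j : Fin n, lam j = μ.rowLen j + (n - 1 - (j : ℕ)))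
    (G : StrictGTPattern n lam) {j c : ℕ} (h : (j, c) ∈ μ) :
    c + (n - 1 - j) < G.1.entry n j := by
  rw [YoungDiagram.mem_iff_lt_rowLen] at h
  have hj : j < n := by
    by_contra hj
    rw [μ.rowLen_eq_zero_of_length_le hμ (by omega)] at h
    omega
  rw [G.2.2 ⟨j, hj⟩, hlam]
  exact Nat.add_lt_add_right h _

open Classical in
/-- The tableau of a pattern without right-saturated triples. -/
noncomputable def toTableau {n : ℕ} {μ : YoungDiagram} (hμ : μ.rowLens.length ≤ n)
    {lam : Fin n → ℕ} (hlam : ∀ j : Fin n, lam j = μ.rowLen j + (n - 1 - (j : ℕ)))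
    (G : StrictGTPattern n lam) (hR : G.1.numR = 0) : SemistandardYoungTableau μ where
  entry j c := if (j, c) ∈ μ then G.tableauEntry j c else 0
  row_weak' {j c c'} hc h := by
    have h' := μ.up_left_mem le_rfl hc.le h
    have ht := lt_entry_top_of_mem hμ hlam G h
    have hv := (G.tableauEntry_lt_iff le_rfl ht).mpr ht
    have h1 := (G.tableauEntry_lt_iff hv ht).mp (Nat.lt_add_one _)
    rw [if_pos h, if_pos h', ← Nat.lt_succ_iff]
    exact (G.tableauEntry_lt_iff hv (lt_entry_top_of_mem hμ hlam G h')).mpr (by omega)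
  col_strict' {j j' c} hj h := by
    have h' := μ.up_left_mem hj.le le_rfl h
    rw [if_pos h, if_pos h']
    have step : ∀ k, (k + 1, c) ∈ μ → G.tableauEntry k c < G.tableauEntry (k + 1) c := by
      intro k hk
      have hk' := μ.up_left_mem (Nat.le_succ k) le_rfl hk
      have ht := lt_entry_top_of_mem hμ hlam G hk
      have hkn : k + 1 < n := by
        by_contra hk1
        rw [G.1.zeros' n (k + 1) (by omega)] at ht
        omega
      have hv := (G.tableauEntry_lt_iff le_rfl ht).mpr ht
      have h1 := (G.tableauEntry_lt_iff (i := G.tableauEntry (k + 1) c + 1) hv ht).mp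
        (Nat.lt_add_one _)
      have hkv : k < G.tableauEntry (k + 1) c := by
        by_contra hkv
        rw [G.1.zeros' _ (k + 1) (by omega)] at h1
        omega
      -- The strict diagonal inequality compensates for the shift being larger by one at position
      -- `k` than at `k + 1`.
      have h2 := G.1.entry_succ_lt_of_numR_eq_zero G.2.1 hR hv hkv
      exact (G.tableauEntry_lt_iff hv.le (lt_entry_top_of_mem hμ hlam G hk')).mpr (by omega)
    clear h'
    induction j', hj using Nat.le_induction with
    | base => exact step j h
    | succ k hk ih => exact (ih (μ.up_left_mem (Nat.le_succ k) le_rfl h)).trans (step k h)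
  zeros' h := if_neg h

theorem toTableau_apply {n : ℕ} {μ : YoungDiagram} (hμ : μ.rowLens.length ≤ n)
    {lam : Fin n → ℕ} (hlam : ∀ j : Fin n, lam j = μ.rowLen j + (n - 1 - (j : ℕ)))
    (G : StrictGTPattern n lam) (hR : G.1.numR = 0) {j c : ℕ} (h : (j, c) ∈ μ) :
    G.toTableau hμ hlam hR j c = G.tableauEntry j c :=
  if_pos h

/-- Following the strict diagonal inequalities up to the top row, then its strict decrease to the
right, gives enough unit drops. Hence subtracting the shift from an entry is a genuine subtraction.
-/
theorem le_entry {n : ℕ} {lam : Fin n → ℕ} (G : StrictGTPattern n lam) (hR : G.1.numR = 0)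
    {i j : ℕ} (hj : j < i) (hi : i ≤ n) : n - 1 - j ≤ G.1.entry i j := by
  induction hd : n - i generalizing i j with
  | zero =>
    obtain rfl : i = n := by omega
    induction hm : i - 1 - j generalizing j with
    | zero => exact Nat.zero_le _
    | succ m ih =>
      have h1 := ih (j := j + 1) (by omega) (by omega)
      have h2 := G.2.1 i j le_rfl (by omega)
      omega
  | succ d ih =>
    have h1 := ih (i := i + 1) (j := j + 1) (by omega) (by omega) (by omega)
    have h2 := G.1.entry_succ_lt_of_numR_eq_zero G.2.1 hR (by omega : i + 1 ≤ n) hj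
    omega

theorem exists_toGTPattern_eq {n : ℕ} {μ : YoungDiagram} (hμ : μ.rowLens.length ≤ n)
    {lam : Fin n → ℕ} (hlam : ∀ j : Fin n, lam j = μ.rowLen j + (n - 1 - (j : ℕ)))
    (G : StrictGTPattern n lam) (hR : G.1.numR = 0) :
    ∃ T : BoundedSSYT n μ, T.toGTPattern = G.1 := by
  refine ⟨⟨G.toTableau hμ hlam hR, fun c hc => ?_⟩, ?_⟩
  · rw [G.toTableau_apply hμ hlam hR hc]
    have ht := lt_entry_top_of_mem hμ hlam G hc
    exact (G.tableauEntry_lt_iff le_rfl ht).mpr ht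
  · apply GTPattern.ext
    funext i j
    by_cases hij : j < i ∧ i ≤ n
    · refine (BoundedSSYT.toGTPattern_entry _ hij.1 hij.2).trans ?_
      have hle := G.le_entry hR hij.1 hij.2
      suffices h : (G.toTableau hμ hlam hR).rowCount i j = G.1.entry i j - (n - 1 - j) by
        change (G.toTableau hμ hlam hR).rowCount i j + _ = _
        omega
      refine eq_of_forall_lt_iff fun c => ?_
      rw [SemistandardYoungTableau.lt_rowCount_iff, ← YoungDiagram.mem_iff_lt_rowLen]
      constructor
      · rintro ⟨h1, h2⟩
        rw [G.toTableau_apply hμ hlam hR h1,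
          G.tableauEntry_lt_iff hij.2 (lt_entry_top_of_mem hμ hlam G h1)] at h2
        omega
      · intro h
        have h1 : (j, c) ∈ μ := by
          rw [YoungDiagram.mem_iff_lt_rowLen]
          have h2 := G.1.entry_le_top i j hij.1 hij.2
          rw [G.2.2 ⟨j, by omega⟩, hlam] at h2
          simp only at h2
          omega
        refine ⟨h1, ?_⟩
        rw [G.toTableau_apply hμ hlam hR h1,
          G.tableauEntry_lt_iff hij.2 (lt_entry_top_of_mem hμ hlam G h1)]
        omega
    · rw [G.1.zeros' i j hij]
      exact GTPattern.zeros' _ i j hij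

end StrictGTPattern

namespace BoundedSSYT

theorem rowSum_toGTPattern {n : ℕ} {μ : YoungDiagram} (T : BoundedSSYT n μ) {i : ℕ}
    (hi : i ≤ n) : T.toGTPattern.rowSum i =
      (μ.cells.filter fun c => T.1 c.1 c.2 < i).card + ∑ j ∈ Finset.range i, (n - 1 - j) := by
  rw [← T.1.sum_rowCount, ← Finset.sum_add_distrib]
  exact Finset.sum_congr rfl fun j hj => T.toGTPattern_entry (Finset.mem_range.mp hj) hi

/-- Passing to row `i + 1` adds the boxes with entry `i` and one new shift; the shifts at old
positions cancel. -/
theorem rowSum_sub_toGTPattern {n : ℕ} {μ : YoungDiagram} (T : BoundedSSYT n μ) {i : ℕ}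
    (hi : i < n) : T.toGTPattern.rowSum (i + 1) - T.toGTPattern.rowSum i =
      (μ.cells.filter fun c => T.1 c.1 c.2 = i).card + (n - 1 - i) := by
  have h : (μ.cells.filter fun c => T.1 c.1 c.2 < i + 1).card =
      (μ.cells.filter fun c => T.1 c.1 c.2 < i).card +
        (μ.cells.filter fun c => T.1 c.1 c.2 = i).card := by
    rw [← Finset.card_union_of_disjoint]
    · congr 1
      ext c
      simp only [Finset.mem_filter, Finset.mem_union, Nat.lt_succ_iff_lt_or_eq]
      tauto
    · refine Finset.disjoint_filter.mpr fun c _ h1 h2 => ?_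
      omega
  rw [T.rowSum_toGTPattern hi, T.rowSum_toGTPattern hi.le, h, Finset.sum_range_succ]
  omega

theorem weight_toGTPattern_zero {R : Type*} [CommRing R] {n : ℕ} {μ : YoungDiagram}
    (T : BoundedSSYT n μ) (x : Fin n → R) :
    T.toGTPattern.weight x 0 = (∏ i : Fin n, ∏ _j ∈ Finset.Ioi i, x i) *
      ∏ c : {c // c ∈ μ.cells}, x ⟨T.1 c.1.1 c.1.2, T.2 c.1 c.2⟩ := by
  have h : ∏ c : {c // c ∈ μ.cells}, x ⟨T.1 c.1.1 c.1.2, T.2 c.1 c.2⟩ =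
      ∏ i : Fin n, x i ^ (μ.cells.filter fun c => T.1 c.1 c.2 = i).card := by
    rw [← Finset.prod_fiberwise (g := fun c : {c // c ∈ μ.cells} =>
      (⟨T.1 c.1.1 c.1.2, T.2 c.1 c.2⟩ : Fin n))]
    refine Finset.prod_congr rfl fun i _ => ?_
    rw [Finset.prod_congr rfl (g := fun _ => x i)
      (fun c hc => by rw [(Finset.mem_filter.mp hc).2]), Finset.prod_const]
    congr 1
    refine Finset.card_bij (fun c _ => c.1) ?_ ?_ ?_
    · intro c hc
      exact Finset.mem_filter.mpr ⟨c.2, congrArg Fin.val (Finset.mem_filter.mp hc).2⟩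
    · intro a _ b _ hab
      exact Subtype.ext hab
    · intro c hc
      rw [Finset.mem_filter] at hc
      exact ⟨⟨c, hc.1⟩, Finset.mem_filter.mpr ⟨Finset.mem_univ _, Fin.ext hc.2⟩, rfl⟩
  rw [GTPattern.weight, numR_toGTPattern, pow_zero, add_zero, one_pow, one_mul, one_mul, h,
    ← Finset.prod_mul_distrib]
  refine Finset.prod_congr rfl fun i _ => ?_
  rw [T.rowSum_sub_toGTPattern i.2, pow_add, mul_comm, Finset.prod_const, Fin.card_Ioi]

end BoundedSSYT

/-! ### The specialization at zero and the descent from polynomials -/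

/-- At `t = 0` the factor `0 ^ numR` kills exactly the patterns that do not come from tableaux. -/
theorem tokuyamaSum_zero {R : Type*} [CommRing R] {n : ℕ} (μ : YoungDiagram)
    (hμ : μ.rowLens.length ≤ n) (lam : Fin n → ℕ)
    (hlam : ∀ j : Fin n, lam j = μ.rowLen j + (n - 1 - (j : ℕ))) (x : Fin n → R) :
    tokuyamaSum lam x 0 =
      (∏ i : Fin n, ∏ _j ∈ Finset.Ioi i, x i) * schurFunction μ x := by
  rw [schurFunction, Finset.mul_sum, tokuyamaSum]
  symm
  refine Finset.sum_of_injOn (fun T : BoundedSSYT n μ => T.toStrictGTPattern lam hlam)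
    ?_ ?_ ?_ ?_
  · intro T _ U _ h
    exact BoundedSSYT.toGTPattern_injective (congrArg Subtype.val h)
  · intro T _
    exact Finset.mem_coe.mpr (Finset.mem_univ _)
  · intro G _ hG
    have hR : G.1.numR ≠ 0 := by
      intro hR
      obtain ⟨T, hT⟩ := G.exists_toGTPattern_eq hμ hlam hR
      exact hG ⟨T, Finset.mem_coe.mpr (Finset.mem_univ _), Subtype.ext hT⟩
    rw [GTPattern.weight, zero_pow hR, zero_mul, zero_mul]
  · intro T _
    exact (T.weight_toGTPattern_zero x).symm

theorem map_tokuyamaSum {R S : Type*} [CommRing R] [CommRing S] (f : R →+* S) {n : ℕ}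
    (lam : Fin n → ℕ) (x : Fin n → R) (t : R) :
    f (tokuyamaSum lam x t) = tokuyamaSum lam (fun i => f (x i)) (f t) := by
  simp [tokuyamaSum, GTPattern.weight, map_sum, map_prod]

theorem map_schurFunction {R S : Type*} [CommRing R] [CommRing S] (f : R →+* S) {n : ℕ}
    (μ : YoungDiagram) (x : Fin n → R) :
    f (schurFunction μ x) = schurFunction μ fun i => f (x i) := by
  simp [schurFunction, map_sum, map_prod]

theorem tokuyamaSum_eq_of_isDomain {R : Type*} [CommRing R] [IsDomain R] {n : ℕ}
    (μ : YoungDiagram) (hμ : μ.rowLens.length ≤ n) (lam : Fin n → ℕ)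
    (hlam : ∀ j : Fin n, lam j = μ.rowLen j + (n - 1 - (j : ℕ)))
    (x : Fin n → R) (hx : Function.Injective x) (hx0 : ∀ i, x i ≠ 0) (t : R) :
    tokuyamaSum lam x t =
      (∏ i : Fin n, ∏ j ∈ Finset.Ioi i, (x i + t * x j)) * schurFunction μ x := by
  have hanti : StrictAnti lam := by
    intro i j hij
    have h1 := μ.rowLen_anti i j hij.le
    have h2 : (i : ℕ) < j := hij
    rw [hlam, hlam]
    omega
  have hV : ∏ i : Fin n, ∏ j ∈ Finset.Ioi i, (x i - x j) ≠ 0 := by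
    refine Finset.prod_ne_zero_iff.mpr fun i _ => Finset.prod_ne_zero_iff.mpr fun j hj => ?_
    exact sub_ne_zero.mpr fun h => (Finset.mem_Ioi.mp hj).ne (hx h)
  have hP : ∏ i : Fin n, ∏ _j ∈ Finset.Ioi i, x i ≠ 0 :=
    Finset.prod_ne_zero_iff.mpr fun i _ => Finset.prod_ne_zero_iff.mpr fun _ _ => hx0 i
  -- After cancelling the monomial factor, this is the bialternant formula for the Schur function.
  have h0 := tokuyamaSum_mul_prod_sub lam hanti x 0
  simp only [zero_mul, add_zero] at h0
  rw [tokuyamaSum_zero μ hμ lam hlam, mul_assoc] at h0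
  refine mul_right_cancel₀ hV ?_
  rw [tokuyamaSum_mul_prod_sub lam hanti, ← mul_left_cancel₀ hP h0, mul_assoc]

theorem mainTheorem5 {R : Type*} [CommRing R] (n : ℕ) (μ : YoungDiagram)
    (hμ : μ.rowLens.length ≤ n) (lam : Fin n → ℕ)
    (hlam : ∀ j : Fin n, lam j = μ.rowLen j + (n - 1 - (j : ℕ)))
    (x : Fin n → R) (t : R) :
    ∑ G : StrictGTPattern n lam, t ^ G.1.numR * (1 + t) ^ G.1.numB *
        ∏ i : Fin n, x i ^ (G.1.rowSum ((i : ℕ) + 1) - G.1.rowSum (i : ℕ)) =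
      (∏ i : Fin n, ∏ j ∈ Finset.Ioi i, (x i + t * x j)) * schurFunction μ x := by
  -- Both sides are integer polynomials in the `x i` and `t`. The variable `none` stands for `t` and
  -- `some i` for `x i`.
  let f : MvPolynomial (Option (Fin n)) ℤ →+* R :=
    (MvPolynomial.aeval fun o : Option (Fin n) => o.elim t x).toRingHom
  have hfx : ∀ i, f (MvPolynomial.X (some i)) = x i := fun i =>
    MvPolynomial.aeval_X (R := ℤ) (fun o : Option (Fin n) => o.elim t x) (some i)
  have hft : f (MvPolynomial.X none) = t :=
    MvPolynomial.aeval_X (R := ℤ) (fun o : Option (Fin n) => o.elim t x) none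
  have h := congrArg f (tokuyamaSum_eq_of_isDomain μ hμ lam hlam
    (fun i => (MvPolynomial.X (some i) : MvPolynomial (Option (Fin n)) ℤ))
    (fun i j hij => Option.some_injective _ (MvPolynomial.X_injective hij))
    (fun i => MvPolynomial.X_ne_zero _) (MvPolynomial.X none))
  rw [map_mul, map_tokuyamaSum, map_schurFunction] at h
  simp only [map_prod, map_add, map_mul, hfx, hft] at h
  exact h
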